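/- Let $\mathcal A\subset\mathbb R^d$ be a finite set of $K\ge 2$ arms, let $\theta\in\mathbb R^d$, and suppose that there is a unique best arm $a^*=\arg\max_{a\in\mathcal A}\langle\theta,a\rangle$. Put $\Delta_{\min}=\min_{a\in\mathcal A,\,a\ne a^*}\langle\theta,a^*-a\rangle$. There are $M$ agents on a star network; an agent that plays the arm $a$ observes $\langle\theta,a\rangle$ plus noise, where the noise variables of all pulls of all agents are independent, zero-mean and $R$-sub-Gaussian with $R>0$, i.e. $\mathbb E\,e^{\lambda\eta}\le e^{\lambda^2R^2/2}$ for all real $\lambda$. Write $\log$ for the logarithm to base $2$, let $T\ge\lceil\log K\rceil$ be the time budget, and $b=\lfloor T/\lceil\log K\rceil\rfloor$. The algorithm MaLinBAI-Star starts with $\mathcal A_1=\mathcal A$ and, in each round $p=1,\dots,\lceil\log K\rceil$, does the following. 1. The active arms $a\in\mathcal A_p$ are replaced, for the computations of the round, by their coordinates $\bar a\in\mathbb R^{d_p}$ in an orthonormal basis of the span of $\mathcal A_p$, where $d_p$ is the dimension of this span. 2. The server computes a $1$-approximate G-optimal design $\pi_p$ on $\mathcal A_p$: a probability distribution with $V(\pi_p)$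 nonsingular and $g(\pi_p)\le 2\,g(\pi)$ for every probability distribution $\pi$ on $\mathcal A_p$ with $V(\pi)$ nonsingular, where $V(\pi)=\sum_{a\in\mathcal A_p}\pi(a)\bar a\bar a^\top$ and $g(\pi)=\max_{a\in\mathcal A_p}\bar a^\top V(\pi)^{-1}\bar a$. 3. Each agent plays each $a\in\mathcal A_p$ exactly $b_p(a)=b\,\pi_p(a)$ times (rounded up if this is not an integer), in any prescribed order, and sends $V_m=\sum_{a\in\mathcal A_p} b_p(a)\bar a\bar a^\top$ and $D_m=\sum_s \bar a_{m,s}r_{m,s}$ to the server, where $a_{m,s}$ and $r_{m,s}$ are the arm and the reward of its $s$-th pull of the round. 4. The server computes $\hat\theta=\big(\sum_m V_m\big)^{-1}\sum_m D_m$ and lets $\mathcal A_{p+1}$ consist of $\lceil K/2^p\rceil$ arms $a\in\mathcal A_p$ with the highest values of $\hat\theta^\top\bar a$, ties being broken by any measurable rule. The output is the only arm in $\mathcal A_{\lceil\log K\rceil+1}$. Then, whatever designs, orders of play and tie-breaking rules are used, $$\Pr[\text{the output is not } a^*]\;\le\;4\log K\,\exp\left(-\frac{TM\Delta_{\min}^2}{32R^2d\log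 K}\right).$$ In particular, for $1$-sub-Gaussian noise the bound is $4\log K\,\exp\left(-\frac{TM\Delta_{\min}^2}{32d\log K}\right)$. -/

import Mathlib

open MeasureTheory ProbabilityTheory
open scoped NNReal

namespace MaLinBAI

noncomputable section

/-- Arms are vectors of `ℝ^d` with the Euclidean inner product. -/
abbrev Arm (d : ℕ) : Type := EuclideanSpace ℝ (Fin d)

/-- The minimal sub-optimality gap `min ⟨θ, aStar - a⟩` over the arms `a ≠ aStar`. -/
def minGap {d : ℕ} (θ : Arm d) (𝒜 : Finset (Arm d)) (aStar : Arm d) : ℝ :=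
  ⨅ a : {a : Arm d // a ∈ 𝒜 ∧ a ≠ aStar}, inner ℝ θ (aStar - a.1)

/-! ### Projection of a set of arms to its span, and G-optimal designs -/

/-- The linear span of a set of arms. -/
abbrev armSpan {d : ℕ} (A : Finset (Arm d)) : Submodule ℝ (Arm d) :=
  Submodule.span ℝ (A : Set (Arm d))

/-- The rank of a set of arms. -/
abbrev armRank {d : ℕ} (A : Finset (Arm d)) : ℕ := Module.finrank ℝ (armSpan A)

/-- Projection to `armRank A` dimensions: the coordinates, in an orthonormal basis of the span
of `A`, of the orthogonal projection onto that span. -/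
def proj {d : ℕ} (A : Finset (Arm d)) (a : Arm d) : Fin (armRank A) → ℝ :=
  fun i => (stdOrthonormalBasis ℝ (armSpan A)).repr ((armSpan A).orthogonalProjectionOnto a) i

/-- The matrix `∑_{a ∈ A} w(a) a aᵀ` of the projected arms. -/
def designMatrix {d : ℕ} (A : Finset (Arm d)) (w : Arm d → ℝ) :
    Matrix (Fin (armRank A)) (Fin (armRank A)) ℝ :=
  ∑ a ∈ A, w a • Matrix.vecMulVec (proj A a) (proj A a)

/-- `g(π) = max_{a ∈ A} ‖a‖²_{V(π)⁻¹}` for the projected arms. -/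
def gValue {d : ℕ} (A : Finset (Arm d)) (π : Arm d → ℝ) : ℝ :=
  ⨆ a : A, proj A a.1 ⬝ᵥ ((designMatrix A π)⁻¹.mulVec (proj A a.1))

/-- A probability distribution on `A` whose design matrix is nonsingular (for the others,
`g` is infinite). -/
def IsDesign {d : ℕ} (A : Finset (Arm d)) (π : Arm d → ℝ) : Prop :=
  (∀ a ∈ A, 0 ≤ π a) ∧ ∑ a ∈ A, π a = 1 ∧ (designMatrix A π).det ≠ 0

/-- An `ε`-approximate G-optimal design: `g(π)` is within a factor `1 + ε` of the minimum. -/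
def IsApproxGOptimal {d : ℕ} (ε : ℝ) (A : Finset (Arm d)) (π : Arm d → ℝ) : Prop :=
  IsDesign A π ∧ ∀ π' : Arm d → ℝ, IsDesign A π' → gValue A π ≤ (1 + ε) * gValue A π'

/-! ### The algorithm -/

/-- The number of rounds `⌈log₂ K⌉`. -/
def numRounds (K : ℕ) : ℕ := ⌈Real.logb 2 K⌉₊

/-- The budget `b = ⌊T / ⌈log₂ K⌉⌋` of one round. -/
def roundBudget (K T : ℕ) : ℕ := T / numRounds K

/-- The number of active arms after `p` rounds of halving: `K / 2^p`, rounded up. -/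
def numActive (K p : ℕ) : ℕ := ⌈(K : ℝ) / 2 ^ p⌉₊

/-- The number of pulls `b π(a)` of the arm `a` (rounded up if it is not an integer). -/
def pulls {d : ℕ} (b : ℕ) (π : Arm d → ℝ) (a : Arm d) : ℕ := ⌈(b : ℝ) * π a⌉₊

/-- The number of pulls of one agent in a round. -/
def roundLength {d : ℕ} (b : ℕ) (A : Finset (Arm d)) (π : Arm d → ℝ) : ℕ :=
  ∑ a ∈ A, pulls b π a

/-- `S` consists of `k` arms of `A` with the highest values of `x`. -/
def IsTop {d : ℕ} (k : ℕ) (A : Finset (Arm d)) (x : Arm d → ℝ) (S : Finset (Arm d)) : Prop :=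
  S ⊆ A ∧ S.card = k ∧ ∀ a ∈ S, ∀ a' ∈ A, a' ∉ S → x a' ≤ x a

/-- What the description of the algorithm leaves open, for an arm set `𝒜`, budget `T` and `M`
agents: which 1-approximate G-optimal design the server computes, in which order an agent plays
the prescribed pulls, and how ties are broken when the top arms are selected. Rounds are numbered
from `0`; `A` is the active set of the round. -/
structure Implementation {d : ℕ} (𝒜 : Finset (Arm d)) (T M : ℕ) where
  /-- the design of round `p` -/
  design : ℕ → Finset (Arm d) → Arm d → ℝ
  design_spec : ∀ p A, A ⊆ 𝒜 → A.Nonempty → IsApproxGOptimal 1 A (design p A)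
  /-- `order p A m s` is the arm that agent `m` plays as its `s`-th pull of round `p` -/
  order : ℕ → Finset (Arm d) → Fin M → ℕ → Arm d
  order_spec : ∀ p A, A ⊆ 𝒜 → A.Nonempty → ∀ m, ∀ a ∈ A,
    {s : ℕ | s < roundLength (roundBudget 𝒜.card T) A (design p A) ∧ order p A m s = a}.ncard
      = pulls (roundBudget 𝒜.card T) (design p A) a
  /-- the active set after round `p`, given the estimated rewards -/
  select : ℕ → Finset (Arm d) → (Arm d → ℝ) → Finset (Arm d)
  select_spec : ∀ p A x, A ⊆ 𝒜 → A.card = numActive 𝒜.card p →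
    IsTop (numActive 𝒜.card (p + 1)) A x (select p A x)
  select_meas : ∀ p A S, MeasurableSet {x : Arm d → ℝ | select p A x = S}

namespace Implementation

variable {d : ℕ} {𝒜 : Finset (Arm d)} {T M : ℕ}

/-- The number of times each agent pulls `a` in round `p` with active set `A`. -/
def numPulls (I : Implementation 𝒜 T M) (p : ℕ) (A : Finset (Arm d)) (a : Arm d) : ℕ :=
  pulls (roundBudget 𝒜.card T) (I.design p A) a

/-- The reward `⟨θ, a⟩ + noise` of the `s`-th pull of agent `m` in round `p`, where
`h m p s` is the noise of that pull. -/
def reward (I : Implementation 𝒜 T M) (θ : Arm d) (h : Fin M → ℕ → ℕ → ℝ)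
    (p : ℕ) (A : Finset (Arm d)) (m : Fin M) (s : ℕ) : ℝ :=
  inner ℝ θ (I.order p A m s) + h m p s

/-- The local matrix `V_m`. -/
def agentV (I : Implementation 𝒜 T M) (p : ℕ) (A : Finset (Arm d)) (_m : Fin M) :
    Matrix (Fin (armRank A)) (Fin (armRank A)) ℝ :=
  designMatrix A (fun a => (I.numPulls p A a : ℝ))

/-- The local vector `D_m`. -/
def agentD (I : Implementation 𝒜 T M) (θ : Arm d) (h : Fin M → ℕ → ℕ → ℝ)
    (p : ℕ) (A : Finset (Arm d)) (m : Fin M) : Fin (armRank A) → ℝ :=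
  ∑ s ∈ Finset.range (roundLength (roundBudget 𝒜.card T) A (I.design p A)),
    I.reward θ h p A m s • proj A (I.order p A m s)

/-- The server's least-squares estimate `V_S⁻¹ D_S`, with `V_S = ∑ V_m` and `D_S = ∑ D_m`. -/
def thetaHat (I : Implementation 𝒜 T M) (θ : Arm d) (h : Fin M → ℕ → ℕ → ℝ)
    (p : ℕ) (A : Finset (Arm d)) : Fin (armRank A) → ℝ :=
  (∑ m, I.agentV p A m)⁻¹.mulVec (∑ m, I.agentD θ h p A m)

/-- The estimated expected reward of an arm. -/
def estimate (I : Implementation 𝒜 T M) (θ : Arm d) (h : Fin M → ℕ → ℕ → ℝ)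
    (p : ℕ) (A : Finset (Arm d)) (a : Arm d) : ℝ :=
  I.thetaHat θ h p A ⬝ᵥ proj A a

/-- The active set after `p` rounds. -/
def active (I : Implementation 𝒜 T M) (θ : Arm d) (h : Fin M → ℕ → ℕ → ℝ) :
    ℕ → Finset (Arm d)
  | 0 => 𝒜
  | p + 1 => I.select p (active I θ h p) (I.estimate θ h p (active I θ h p))

/-- The algorithm outputs `a`: it is the only arm that is active after the last round. -/
def Outputs (I : Implementation 𝒜 T M) (θ : Arm d) (h : Fin M → ℕ → ℕ → ℝ) (a : Arm d) : Prop :=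
  I.active θ h (numRounds 𝒜.card) = {a}

end Implementation

end

end MaLinBAI

namespace MaLinBAI

open Matrix

/-! ### Projected arms, design matrices and the inverse quadratic form. -/

section LinearAlgebra

variable {d : ℕ}

/-! Fix a round and a value `A` of its active set with `aStar ∈ A`. The difference of two estimates
is the true gap plus a linear combination of noises, with variance proxy `R² / M` times `invSq
(pullMatrix ..)` of the difference of the projected arms (`estimate_sub_estimate`,
`sum_noiseWeight_sq`). By Kiefer–Wolfowitz (`exists_isDesign_invSq_le`) the design has `g`-value at
most twice the rank, so this form is at most `8 d / b`, and a sub-Gaussian tail bounds by some `E`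
the probability that a given arm overtakes `aStar`.

If `aStar` is dropped, every selected arm has overtaken it. These are at least half of `A`, so
Markov's inequality for their number gives `2 * E`, with no factor `K`. The active set depends only
on the noise of earlier rounds, so summing over its values preserves this bound
(`measureReal_eliminated_le`). A union bound over the rounds costs `⌈log K⌉ ≤ 2 log K`.

The constant 32 must also absorb the floor and ceiling in `b`. This works for `b ≥ 2`, where `T ≤ 2
b log K`. For `b = 1` that inequality can fail; there, rounding pulls up to whole numbers improves 8
to 6, and `3 T ≤ 8 log K` suffices (`exists_width`). -/

theorem proj_sub (A : Finset (Arm d)) (x y : Arm d) : proj A (x - y) = proj A x - proj A y := by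
  ext i
  simp [proj]

theorem proj_smul (A : Finset (Arm d)) (c : ℝ) (x : Arm d) : proj A (c • x) = c • proj A x := by
  ext i
  simp [proj]

theorem proj_dotProduct_proj {A : Finset (Arm d)} (x : Arm d) {a : Arm d} (ha : a ∈ armSpan A) :
    proj A x ⬝ᵥ proj A a = inner ℝ x a := by
  have h1 : proj A x ⬝ᵥ proj A a = inner ℝ
      ((stdOrthonormalBasis ℝ (armSpan A)).repr ((armSpan A).orthogonalProjectionOnto x))
      ((stdOrthonormalBasis ℝ (armSpan A)).repr ((armSpan A).orthogonalProjectionOnto a)) := by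
    rw [PiLp.inner_apply]
    exact Finset.sum_congr rfl fun i _ => mul_comm _ _
  rw [h1, LinearIsometryEquiv.inner_map_map, Submodule.inner_orthogonalProjectionOnto_eq_of_mem_right]
  exact congrArg (fun z : armSpan A => inner ℝ x (z : Arm d))
    ((armSpan A).orthogonalProjectionOnto_mem_subspace_eq_self ⟨a, ha⟩)

/-- The projected arms span the coordinate space. -/
theorem eq_zero_of_proj_dotProduct_eq_zero {A : Finset (Arm d)} {y : Fin (armRank A) → ℝ}
    (h : ∀ a ∈ A, proj A a ⬝ᵥ y = 0) : y = 0 := by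
  set v : armSpan A := (stdOrthonormalBasis ℝ (armSpan A)).repr.symm (WithLp.toLp 2 y) with hv
  have hproj : proj A (v : Arm d) = y := by
    ext i
    simp [proj, hv]
  have hz : ∀ z ∈ armSpan A, inner ℝ (v : Arm d) z = 0 := by
    intro z hz
    induction hz using Submodule.span_induction with
    | mem a ha =>
      rw [← proj_dotProduct_proj _ (Submodule.subset_span ha), hproj, dotProduct_comm, h a ha]
    | zero => simp
    | add x y _ _ hx hy => rw [inner_add_right, hx, hy, add_zero]
    | smul c x _ hx => rw [inner_smul_right, hx, mul_zero]
  have hv0 : (v : Arm d) = 0 := inner_self_eq_zero.1 (hz _ v.2)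
  rw [← hproj, hv0]
  ext i
  simp [proj]

/-- The squared norm `xᵀ V⁻¹ x`. -/
noncomputable def invSq {r : ℕ} (V : Matrix (Fin r) (Fin r) ℝ) (x : Fin r → ℝ) : ℝ :=
  x ⬝ᵥ (V⁻¹ *ᵥ x)

theorem dotProduct_designMatrix_mulVec (A : Finset (Arm d)) (w : Arm d → ℝ)
    (x y : Fin (armRank A) → ℝ) :
    x ⬝ᵥ (designMatrix A w *ᵥ y) = ∑ a ∈ A, w a * ((proj A a ⬝ᵥ x) * (proj A a ⬝ᵥ y)) := by
  simp only [designMatrix, sum_mulVec, dotProduct_sum, smul_mulVec, dotProduct_smul, smul_eq_mul,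
    vecMulVec_mulVec]
  refine Finset.sum_congr rfl fun a _ => ?_
  rw [dotProduct_comm x]
  simp

theorem designMatrix_isHermitian (A : Finset (Arm d)) (w : Arm d → ℝ) :
    (designMatrix A w).IsHermitian := by
  rw [IsHermitian, conjTranspose_eq_transpose_of_trivial, designMatrix, transpose_sum]
  refine Finset.sum_congr rfl fun a _ => ?_
  rw [transpose_smul, transpose_vecMulVec]

theorem designMatrix_posSemidef {A : Finset (Arm d)} {w : Arm d → ℝ} (hw : ∀ a ∈ A, 0 ≤ w a) :
    (designMatrix A w).PosSemidef := by
  refine PosSemidef.of_dotProduct_mulVec_nonneg (designMatrix_isHermitian A w) fun x => ?_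
  rw [star_trivial, dotProduct_designMatrix_mulVec]
  exact Finset.sum_nonneg fun a ha => mul_nonneg (hw a ha) (mul_self_nonneg _)

theorem designMatrix_posDef {A : Finset (Arm d)} {w : Arm d → ℝ} (hw : ∀ a ∈ A, 0 ≤ w a)
    (hdet : (designMatrix A w).det ≠ 0) : (designMatrix A w).PosDef :=
  (designMatrix_posSemidef hw).posDef_iff_det_ne_zero.2 hdet

theorem designMatrix_posDef_of_pos {A : Finset (Arm d)} {w : Arm d → ℝ} (hw : ∀ a ∈ A, 0 < w a) :
    (designMatrix A w).PosDef := by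
  refine PosDef.of_dotProduct_mulVec_pos (designMatrix_isHermitian A w) fun x hx => ?_
  rw [star_trivial, dotProduct_designMatrix_mulVec]
  have hne : ∃ a ∈ A, proj A a ⬝ᵥ x ≠ 0 := by
    by_contra! h
    exact hx (eq_zero_of_proj_dotProduct_eq_zero h)
  obtain ⟨a, ha, hax⟩ := hne
  exact Finset.sum_pos' (fun a ha => mul_nonneg (hw a ha).le (mul_self_nonneg _))
    ⟨a, ha, mul_pos (hw a ha) (mul_self_pos.2 hax)⟩

section InvSq

variable {r : ℕ} {V : Matrix (Fin r) (Fin r) ℝ}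

theorem invSq_nonneg (hV : V.PosDef) (x : Fin r → ℝ) : 0 ≤ invSq V x := by
  simpa [invSq] using hV.inv.posSemidef.dotProduct_mulVec_nonneg x

theorem mulVec_inv_mulVec (hV : V.PosDef) (x : Fin r → ℝ) : V *ᵥ (V⁻¹ *ᵥ x) = x := by
  rw [mulVec_mulVec, mul_nonsing_inv _ ((isUnit_iff_isUnit_det V).1 hV.isUnit), one_mulVec]

theorem invSq_smul (c : ℝ) (x : Fin r → ℝ) : invSq V (c • x) = c ^ 2 * invSq V x := by
  simp only [invSq, mulVec_smul, dotProduct_smul, smul_dotProduct, smul_eq_mul]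
  ring

theorem invSq_sub_le (hV : V.PosDef) (x y : Fin r → ℝ) :
    invSq V (x - y) ≤ 2 * invSq V x + 2 * invSq V y := by
  have h := invSq_nonneg hV (x + y)
  simp only [invSq, mulVec_add, mulVec_sub, dotProduct_add, dotProduct_sub, add_dotProduct,
    sub_dotProduct] at *
  linarith

/-- Cauchy–Schwarz for the dual pair of norms of a positive definite matrix. -/
theorem dotProduct_sq_le_invSq_mul (hV : V.PosDef) (x y : Fin r → ℝ) :
    (x ⬝ᵥ y) ^ 2 ≤ invSq V x * (y ⬝ᵥ (V *ᵥ y)) := by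
  have hsymm : ∀ u v : Fin r → ℝ, u ⬝ᵥ (V *ᵥ v) = v ⬝ᵥ (V *ᵥ u) := by
    intro u v
    have ht : Vᵀ = V := by simpa using hV.isHermitian.eq
    rw [dotProduct_mulVec, ← mulVec_transpose, ht, dotProduct_comm]
  set z := V⁻¹ *ᵥ x with hz
  have hVz : V *ᵥ z = x := mulVec_inv_mulVec hV x
  have hQ : invSq V x = z ⬝ᵥ (V *ᵥ z) := by rw [hVz, invSq, dotProduct_comm]
  have hxy : x ⬝ᵥ y = y ⬝ᵥ (V *ᵥ z) := by rw [hVz, dotProduct_comm]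
  -- The quadratic form of `V` at `t • z + y` is nonnegative in `t`, so its discriminant is
  -- nonpositive.
  have key : ∀ t : ℝ, 0 ≤ (z ⬝ᵥ (V *ᵥ z)) * (t * t) + (2 * (x ⬝ᵥ y)) * t + y ⬝ᵥ (V *ᵥ y) := by
    intro t
    have h := hV.posSemidef.dotProduct_mulVec_nonneg (t • z + y)
    simp only [star_trivial, mulVec_add, mulVec_smul, dotProduct_add, add_dotProduct,
      dotProduct_smul, smul_dotProduct, smul_eq_mul] at h
    rw [hsymm z y, ← hxy] at h
    linarith
  have := discrim_le_zero key
  rw [discrim] at this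
  rw [hQ]
  linarith

/-- Inversion reverses the Loewner order. -/
theorem invSq_le_of_smul_le {W : Matrix (Fin r) (Fin r) ℝ} (hV : V.PosDef) (hW : W.PosDef)
    {c : ℝ} (hc : 0 < c) (h : ∀ y : Fin r → ℝ, c * (y ⬝ᵥ (V *ᵥ y)) ≤ y ⬝ᵥ (W *ᵥ y))
    (x : Fin r → ℝ) : c * invSq W x ≤ invSq V x := by
  set y := W⁻¹ *ᵥ x with hy
  have hq : invSq W x = y ⬝ᵥ (W *ᵥ y) := by rw [mulVec_inv_mulVec hW, invSq, dotProduct_comm]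
  have hxy : x ⬝ᵥ y = invSq W x := rfl
  have h1 := dotProduct_sq_le_invSq_mul hV x y
  have h2 := h y
  rw [hxy] at h1
  rw [← hq] at h2
  have h0 := invSq_nonneg hW x
  have h3 := invSq_nonneg hV x
  rcases h0.eq_or_lt with h0 | h0
  · rw [← h0]; simpa using h3
  · have h4 : c * invSq W x * invSq W x ≤ invSq V x * invSq W x := by
      calc c * invSq W x * invSq W x = c * (invSq W x) ^ 2 := by ring
        _ ≤ c * (invSq V x * (y ⬝ᵥ (V *ᵥ y))) := by gcongr
        _ = invSq V x * (c * (y ⬝ᵥ (V *ᵥ y))) := by ring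
        _ ≤ invSq V x * invSq W x := by gcongr
    exact le_of_mul_le_mul_right h4 h0

theorem invSq_const_smul (c : ℝ) (x : Fin r → ℝ) (hV : V.PosDef) (hc : c ≠ 0) :
    invSq (c • V) x = c⁻¹ * invSq V x := by
  have : (c • V)⁻¹ = c⁻¹ • V⁻¹ := by
    apply inv_eq_right_inv
    rw [smul_mul_smul_comm, mul_inv_cancel₀ hc, one_smul,
      mul_nonsing_inv _ ((isUnit_iff_isUnit_det V).1 hV.isUnit)]
  rw [invSq, this, smul_mulVec, dotProduct_smul, smul_eq_mul, invSq]

/-- Matrix determinant lemma in terms of `invSq`. -/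
theorem det_smul_add_vecMulVec (hV : V.PosDef) {c : ℝ} (hc : c ≠ 0) (t : ℝ) (x : Fin r → ℝ) :
    (c • V + t • vecMulVec x x).det = c ^ r * V.det * (1 + t / c * invSq V x) := by
  have hu : IsUnit (c • V).det := by
    rw [det_smul]
    exact ((isUnit_iff_ne_zero.2 hc).pow _).mul ((isUnit_iff_isUnit_det V).1 hV.isUnit)
  have h := det_add_replicateCol_mul_replicateRow (ι := Unit) hu (t • x) x
  have h2 : replicateCol Unit (t • x) * replicateRow Unit x = t • vecMulVec x x := by
    ext i j; simp [vecMulVec, mul_apply, mul_assoc]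
  have h3 : (replicateRow Unit x * (c • V)⁻¹ * replicateCol Unit (t • x)) () ()
      = t * invSq (c • V) x := by
    rw [invSq, Matrix.mul_assoc, ← replicateCol_mulVec, mulVec_smul]
    simp [mul_apply, dotProduct, Finset.mul_sum]
    exact Finset.sum_congr rfl fun i _ => by ring
  rw [← h2, h, det_unique (n := Unit), Matrix.add_apply, one_apply_eq, det_smul, Fintype.card_fin,
    show (default : Unit) = () from rfl, h3, invSq_const_smul c x hV hc]
  ring

end InvSq

theorem designMatrix_posDef_of_le {A : Finset (Arm d)} {w v : Arm d → ℝ} {c : ℝ} (hc : 0 < c)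
    (hV : (designMatrix A v).PosDef) (h : ∀ a ∈ A, c * v a ≤ w a) :
    (designMatrix A w).PosDef := by
  refine PosDef.of_dotProduct_mulVec_pos (designMatrix_isHermitian A w) fun x hx => ?_
  have h1 := hV.dotProduct_mulVec_pos hx
  rw [star_trivial, dotProduct_designMatrix_mulVec] at *
  refine (mul_pos hc h1).trans_le ?_
  rw [Finset.mul_sum]
  refine Finset.sum_le_sum fun a ha => ?_
  rw [← mul_assoc]
  exact mul_le_mul_of_nonneg_right (h a ha) (mul_self_nonneg _)

theorem invSq_designMatrix_anti {A : Finset (Arm d)} {w v : Arm d → ℝ} {c : ℝ} (hc : 0 < c)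
    (hV : (designMatrix A v).PosDef) (h : ∀ a ∈ A, c * v a ≤ w a) (x : Fin (armRank A) → ℝ) :
    c * invSq (designMatrix A w) x ≤ invSq (designMatrix A v) x := by
  refine invSq_le_of_smul_le hV (designMatrix_posDef_of_le hc hV h) hc (fun y => ?_) x
  simp only [dotProduct_designMatrix_mulVec, Finset.mul_sum, ← mul_assoc]
  refine Finset.sum_le_sum fun a ha => ?_
  rw [mul_assoc, mul_assoc (w a)]
  exact mul_le_mul_of_nonneg_right (h a ha) (mul_self_nonneg _)

/-- The matrix dominates its single summand at `a`. Evaluating both forms at `y = V⁻¹ a` gives `w q²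
≤ q` for `q = invSq V a`. -/
theorem weight_mul_invSq_le_one {A : Finset (Arm d)} {w : Arm d → ℝ} (hw : ∀ a ∈ A, 0 ≤ w a)
    (hV : (designMatrix A w).PosDef) {a : Arm d} (ha : a ∈ A) :
    w a * invSq (designMatrix A w) (proj A a) ≤ 1 := by
  set V := designMatrix A w with hVdef
  set y := V⁻¹ *ᵥ proj A a with hy
  have h0 := invSq_nonneg hV (proj A a)
  have hq : invSq V (proj A a) = y ⬝ᵥ (V *ᵥ y) := by
    rw [mulVec_inv_mulVec hV, invSq, dotProduct_comm]
  have hge : w a * (invSq V (proj A a) * invSq V (proj A a)) ≤ invSq V (proj A a) := by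
    nth_rewrite 3 [hq]
    rw [hVdef, dotProduct_designMatrix_mulVec]
    exact Finset.single_le_sum (f := fun a' => w a' * ((proj A a' ⬝ᵥ y) * (proj A a' ⬝ᵥ y)))
      (fun a ha => mul_nonneg (hw a ha) (mul_self_nonneg _)) ha
  rcases h0.eq_or_lt with h0 | h0
  · rw [← h0]; simp
  · rw [← mul_assoc] at hge
    exact le_of_mul_le_mul_right (by linarith) h0

/-- Both sides are the trace of `V⁻¹ * V`. -/
theorem sum_weight_mul_invSq {A : Finset (Arm d)} {w : Arm d → ℝ}
    (hV : (designMatrix A w).PosDef) :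
    ∑ a ∈ A, w a * invSq (designMatrix A w) (proj A a) = armRank A := by
  set V := designMatrix A w with hVdef
  have h1 : (V⁻¹ * V).trace = armRank A := by
    rw [nonsing_inv_mul _ ((isUnit_iff_isUnit_det V).1 hV.isUnit), trace_one, Fintype.card_fin]
  rw [← h1]
  nth_rewrite 3 [hVdef]
  rw [designMatrix, Finset.mul_sum, trace_sum]
  refine Finset.sum_congr rfl fun a _ => ?_
  rw [Matrix.mul_smul, trace_smul, smul_eq_mul, mul_vecMulVec, trace_vecMulVec, invSq,
    dotProduct_comm]

end LinearAlgebra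

/-! ### G-optimal designs and their rounding to whole pulls. -/

section Design

variable {d : ℕ}

/-- The left side of `h` is 1 at `t = 0` with derivative `y - r`, which therefore cannot be
positive. Bernoulli's inequality and an explicit small `t` replace the derivative. -/
theorem le_of_forall_one_sub_pow_mul_le {r : ℕ} {y : ℝ} (hy : 0 ≤ y)
    (h : ∀ t : ℝ, 0 < t → t < 1 → (1 - t) ^ r * (1 + t / (1 - t) * y) ≤ 1) : y ≤ r := by
  by_contra! hlt
  have hr : (0 : ℝ) ≤ r := r.cast_nonneg
  have hD : (0 : ℝ) < (r + 1) * (y + 1) := by positivity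
  -- Small enough that `r * t * y < y - r`, which makes `(1 - r t)(1 + t y)` exceed 1.
  set t := (y - r) / ((r + 1) * (y + 1)) with ht
  have ht0 : 0 < t := div_pos (by linarith) hD
  have ht1 : t < 1 := by
    rw [ht, div_lt_one hD]
    nlinarith
  have hrty : r * t * y < y - r := by
    have hmul : t * ((r + 1) * (y + 1)) = y - r := div_mul_cancel₀ _ hD.ne'
    nlinarith [mul_nonneg hr hy]
  have hb : 1 - r * t ≤ (1 - t) ^ r := by
    have := one_add_mul_le_pow (a := -t) (by linarith) r
    simpa [sub_eq_add_neg] using this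
  have h1 : 1 + t * y ≤ 1 + t / (1 - t) * y := by
    have : t ≤ t / (1 - t) := by
      rw [le_div_iff₀ (by linarith)]
      nlinarith
    nlinarith
  have h2 : (1 - r * t) * (1 + t * y) ≤ 1 :=
    calc (1 - r * t) * (1 + t * y) ≤ (1 - t) ^ r * (1 + t * y) := by gcongr
      _ ≤ (1 - t) ^ r * (1 + t / (1 - t) * y) := by
        have : 0 ≤ (1 - t) ^ r := pow_nonneg (by linarith) r
        gcongr
      _ ≤ 1 := h t ht0 ht1
  nlinarith

/-- One half of the Kiefer–Wolfowitz theorem: a D-optimal design has `g`-value at most the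
dimension. -/
theorem exists_isDesign_invSq_le {A : Finset (Arm d)} (hA : A.Nonempty) :
    ∃ π : Arm d → ℝ, IsDesign A π ∧
      ∀ a ∈ A, invSq (designMatrix A π) (proj A a) ≤ armRank A := by
  classical
  let ext : (A → ℝ) → Arm d → ℝ := fun w a => if h : a ∈ A then w ⟨a, h⟩ else 0
  have hext : ∀ w (a : A), ext w a = w a := fun w a => by simp [ext]
  have hsum : ∀ w, ∑ a ∈ A, ext w a = ∑ a : A, w a := fun w => by
    rw [← Finset.sum_coe_sort]
    exact Finset.sum_congr rfl fun a _ => hext w a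
  have hcont : Continuous fun w => (designMatrix A (ext w)).det := by
    refine Continuous.matrix_det ?_
    refine continuous_finsetSum _ fun a ha => ?_
    have : Continuous fun w => ext w a := by
      simp only [ext, ha, dite_true]
      fun_prop
    fun_prop
  have hcard : (0 : ℝ) < A.card := by exact_mod_cast hA.card_pos
  have hunif : (fun _ : A => (A.card : ℝ)⁻¹) ∈ stdSimplex ℝ A :=
    ⟨fun _ => by positivity, by simp [hcard.ne']⟩
  obtain ⟨w, hw, hmax⟩ := (isCompact_stdSimplex ℝ A).exists_isMaxOn ⟨_, hunif⟩ hcont.continuousOn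
  have hpos : ∀ a ∈ A, 0 ≤ ext w a := fun a ha => by simpa [ext, ha] using hw.1 ⟨a, ha⟩
  -- The uniform weights already give a positive determinant, hence so does the maximizer.
  have hdet : 0 < (designMatrix A (ext w)).det := by
    refine lt_of_lt_of_le (PosDef.det_pos ?_) (hmax hunif)
    refine designMatrix_posDef_of_pos fun a ha => ?_
    simp only [ext, ha, dite_true]
    positivity
  have hV := designMatrix_posDef hpos hdet.ne'
  refine ⟨ext w, ⟨hpos, by rw [hsum, hw.2], hdet.ne'⟩, fun a ha => ?_⟩
  refine le_of_forall_one_sub_pow_mul_le (invSq_nonneg hV _) fun t ht0 ht1 => ?_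
  -- Moving a fraction `t` of the mass to `a` is a rank-one update of the matrix; maximality of the
  -- determinant then bounds `invSq` at `a`.
  set w' : A → ℝ := fun a' => (1 - t) * w a' + t * if a' = ⟨a, ha⟩ then 1 else 0 with hw'
  have hmem : w' ∈ stdSimplex ℝ A := by
    refine ⟨fun a' => ?_, ?_⟩
    · have := hw.1 a'
      have h1 : (0 : ℝ) ≤ 1 - t := by linarith
      simp only [hw']
      split_ifs <;> positivity
    · simp only [hw', Finset.sum_add_distrib, ← Finset.mul_sum, hw.2]
      simp
  have hmat : designMatrix A (ext w') =
      (1 - t) • designMatrix A (ext w) + t • vecMulVec (proj A a) (proj A a) := by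
    have h1 : ∀ a' ∈ A, ext w' a' • vecMulVec (proj A a') (proj A a') =
        (1 - t) • ext w a' • vecMulVec (proj A a') (proj A a') +
        if a' = a then t • vecMulVec (proj A a') (proj A a') else 0 := by
      intro a' ha'
      simp only [ext, ha', dite_true, hw', Subtype.mk.injEq]
      split_ifs <;> simp [add_smul, mul_smul]
    rw [designMatrix, Finset.sum_congr rfl h1, Finset.sum_add_distrib, ← Finset.smul_sum,
      Finset.sum_ite_eq' A a, if_pos ha]
    rfl
  have hle : (designMatrix A (ext w')).det ≤ (designMatrix A (ext w)).det := hmax hmem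
  rw [hmat, det_smul_add_vecMulVec hV (by linarith)] at hle
  refine le_of_mul_le_mul_right ?_ hdet
  linarith

theorem invSq_le_gValue {A : Finset (Arm d)} (π : Arm d → ℝ) {a : Arm d} (ha : a ∈ A) :
    invSq (designMatrix A π) (proj A a) ≤ gValue A π :=
  le_ciSup (f := fun a : A => invSq (designMatrix A π) (proj A a.1)) (Set.finite_range _).bddAbove
    ⟨a, ha⟩

theorem IsDesign.posDef {A : Finset (Arm d)} {π : Arm d → ℝ} (h : IsDesign A π) :
    (designMatrix A π).PosDef := designMatrix_posDef h.1 h.2.2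

theorem IsApproxGOptimal.invSq_le {A : Finset (Arm d)} {π : Arm d → ℝ}
    (h : IsApproxGOptimal 1 A π) {a : Arm d} (ha : a ∈ A) :
    invSq (designMatrix A π) (proj A a) ≤ 2 * armRank A := by
  obtain ⟨π', hπ', hle⟩ := exists_isDesign_invSq_le ⟨a, ha⟩
  have : Nonempty A := ⟨⟨a, ha⟩⟩
  have h1 : gValue A π' ≤ armRank A := ciSup_le fun a => hle a.1 a.2
  have h2 := (invSq_le_gValue π ha).trans (h.2 π' hπ')
  linarith

section Pulls

variable {A : Finset (Arm d)} {π : Arm d → ℝ} {b : ℕ}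

theorem mul_weight_le_pulls (a : Arm d) : (b : ℝ) * π a ≤ (pulls b π a : ℝ) := Nat.le_ceil _

theorem one_le_pulls (hb : 0 < b) {a : Arm d} (ha : 0 < π a) : (1 : ℝ) ≤ pulls b π a := by
  have : 0 < pulls b π a := Nat.ceil_pos.2 (by positivity)
  exact_mod_cast this

/-- The design matrix of the pulls of one agent. -/
noncomputable abbrev pullMatrix (b : ℕ) (A : Finset (Arm d)) (π : Arm d → ℝ) :
    Matrix (Fin (armRank A)) (Fin (armRank A)) ℝ :=
  designMatrix A fun a => (pulls b π a : ℝ)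

theorem pullMatrix_posDef (h : IsDesign A π) (hb : 0 < b) : (pullMatrix b A π).PosDef :=
  designMatrix_posDef_of_le (c := b) (by positivity) h.posDef fun a _ => mul_weight_le_pulls a

theorem mul_invSq_pullMatrix_le (h : IsApproxGOptimal 1 A π) (hb : 0 < b) {a : Arm d}
    (ha : a ∈ A) : b * invSq (pullMatrix b A π) (proj A a) ≤ 2 * armRank A :=
  (invSq_designMatrix_anti (by positivity) h.1.posDef (fun a _ => mul_weight_le_pulls a) _).trans
    (h.invSq_le ha)

/-- The constant is `2 * 2 + 2 * 2`: each arm contributes twice the rank, and `invSq_sub_le` doubles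
each contribution. -/
theorem mul_invSq_pullMatrix_sub_le (h : IsApproxGOptimal 1 A π) (hb : 0 < b) {a a' : Arm d}
    (ha : a ∈ A) (ha' : a' ∈ A) :
    b * invSq (pullMatrix b A π) (proj A a - proj A a') ≤ 8 * armRank A := by
  have h1 := mul_invSq_pullMatrix_le h hb ha
  have h2 := mul_invSq_pullMatrix_le h hb ha'
  have h3 := invSq_sub_le (pullMatrix_posDef h.1 hb) (proj A a) (proj A a')
  have hb' : (0 : ℝ) ≤ b := b.cast_nonneg
  nlinarith

theorem invSq_pullMatrix_le_one (h : IsDesign A π) (hb : 0 < b) {a : Arm d} (ha : a ∈ A)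
    (hπ : 0 < π a) : invSq (pullMatrix b A π) (proj A a) ≤ 1 := by
  have hV := pullMatrix_posDef h hb
  have h1 := weight_mul_invSq_le_one (fun a _ => Nat.cast_nonneg _) hV ha
  have h2 := one_le_pulls hb hπ
  have h3 := invSq_nonneg hV (proj A a)
  nlinarith

theorem invSq_pullMatrix_sub_le_of_pos (h : IsApproxGOptimal 1 A π) (hb : 0 < b) {a a' : Arm d}
    (ha : a ∈ A) (ha' : a' ∈ A) (hpos : 0 < π a ∨ 0 < π a') :
    invSq (pullMatrix b A π) (proj A a - proj A a') ≤ 2 + 4 * armRank A := by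
  have hV := pullMatrix_posDef h.1 hb
  have h3 := invSq_sub_le hV (proj A a) (proj A a')
  have hb' : (1 : ℝ) ≤ b := by exact_mod_cast hb
  have bound : ∀ c ∈ A, invSq (pullMatrix b A π) (proj A c) ≤ 2 * armRank A := fun c hc => by
    have h1 := mul_invSq_pullMatrix_le h hb hc
    have h2 := invSq_nonneg hV (proj A c)
    nlinarith
  rcases hpos with hp | hp
  · linarith [invSq_pullMatrix_le_one h.1 hb ha hp, bound a' ha']
  · linarith [invSq_pullMatrix_le_one h.1 hb ha' hp, bound a ha]

/-- In the trace identity the term of `a` is at most 1 and the others add up to at most `2 r (1 - π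
a)`. So `r ≤ 1 + 2 r (1 - π a)`, which forces `r < 2` once `π a > 3 / 4`. -/
theorem IsApproxGOptimal.weight_le (h : IsApproxGOptimal 1 A π) (hr : 2 ≤ armRank A) {a : Arm d}
    (ha : a ∈ A) : π a ≤ 3 / 4 := by
  classical
  have htr := sum_weight_mul_invSq h.1.posDef
  have hone := weight_mul_invSq_le_one h.1.1 h.1.posDef ha
  rw [← Finset.add_sum_erase _ _ ha] at htr
  have hsum := h.1.2.1
  rw [← Finset.add_sum_erase _ _ ha] at hsum
  have hle : ∑ c ∈ A.erase a, π c * invSq (designMatrix A π) (proj A c) ≤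
      ∑ c ∈ A.erase a, π c * (2 * armRank A) :=
    Finset.sum_le_sum fun c hc => mul_le_mul_of_nonneg_left
      (h.invSq_le (Finset.mem_of_mem_erase hc)) (h.1.1 c (Finset.mem_of_mem_erase hc))
  rw [← Finset.sum_mul] at hle
  have hr' : (2 : ℝ) ≤ armRank A := by exact_mod_cast hr
  have hS : ∑ c ∈ A.erase a, π c = 1 - π a := by linarith
  rw [hS] at hle
  by_contra! hlt
  nlinarith

/-- Rounding a positive weight up to at least 1 multiplies it by at least `4 / 3`, because no weight
exceeds `3 / 4`. This turns 8 into 6. -/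
theorem invSq_pullMatrix_one_sub_le (h : IsApproxGOptimal 1 A π) (hr : 2 ≤ armRank A)
    {a a' : Arm d} (ha : a ∈ A) (ha' : a' ∈ A) :
    invSq (pullMatrix 1 A π) (proj A a - proj A a') ≤ 6 * armRank A := by
  have hle : ∀ c ∈ A, (4 / 3 : ℝ) * π c ≤ pulls 1 π c := fun c hc => by
    rcases (h.1.1 c hc).eq_or_lt with h0 | h0
    · rw [← h0, mul_zero]
      exact Nat.cast_nonneg _
    · linarith [one_le_pulls one_pos h0, h.weight_le hr hc]
  have h1 := invSq_designMatrix_anti (by norm_num) h.1.posDef hle (proj A a - proj A a')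
  have h2 := invSq_sub_le h.1.posDef (proj A a) (proj A a')
  linarith [h.invSq_le ha, h.invSq_le ha']

theorem armRank_le (A : Finset (Arm d)) : armRank A ≤ d := by
  simpa using Submodule.finrank_le (armSpan A)

theorem armRank_pos {a a' : Arm d} (ha : a ∈ A) (ha' : a' ∈ A) (hne : a ≠ a') :
    0 < armRank A := by
  rw [Module.finrank_pos_iff]
  exact ⟨⟨a, Submodule.subset_span ha⟩, ⟨a', Submodule.subset_span ha'⟩,
    fun h => hne (congrArg Subtype.val h)⟩

variable {θ aStar : Arm d} {δ : ℝ}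

theorem sq_mul_invSq_pullMatrix_le (h : IsApproxGOptimal 1 A π) (hb : 0 < b) (hδ : 0 ≤ δ)
    (hgap : ∀ c ∈ A, c ≠ aStar → δ ≤ inner ℝ θ (aStar - c)) (hs : aStar ∈ A) {a : Arm d}
    (ha : a ∈ A) (hne : a ≠ aStar) :
    δ ^ 2 * invSq (pullMatrix b A π) (proj A a - proj A aStar) ≤
      8 * d / b * inner ℝ θ (aStar - a) ^ 2 := by
  have h1 := mul_invSq_pullMatrix_sub_le h hb ha hs
  have hd : (armRank A : ℝ) ≤ d := by exact_mod_cast armRank_le A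
  have hb' : (0 : ℝ) < b := by exact_mod_cast hb
  have h2 : invSq (pullMatrix b A π) (proj A a - proj A aStar) ≤ 8 * d / b := by
    rw [le_div_iff₀ hb']
    linarith
  have h3 : δ ^ 2 ≤ inner ℝ θ (aStar - a) ^ 2 := by gcongr; exact hgap a ha hne
  rw [mul_comm]
  gcongr

/-- With a round budget of one pull, each arm in the support of the design is pulled once,
which improves the constant `8` of the general bound to `6`. -/
theorem sq_mul_invSq_pullMatrix_one_le (h : IsApproxGOptimal 1 A π) (hδ : 0 ≤ δ)
    (hgap : ∀ c ∈ A, c ≠ aStar → δ ≤ inner ℝ θ (aStar - c)) (hs : aStar ∈ A) {a : Arm d}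
    (ha : a ∈ A) (hne : a ≠ aStar) :
    δ ^ 2 * invSq (pullMatrix 1 A π) (proj A a - proj A aStar) ≤
      6 * d * inner ℝ θ (aStar - a) ^ 2 := by
  have hrd := armRank_le A
  have hrd' : (armRank A : ℝ) ≤ d := by exact_mod_cast hrd
  have hrpos := armRank_pos ha hs hne
  have conclude : ∀ c ∈ A, c ≠ aStar →
      invSq (pullMatrix 1 A π) (proj A c - proj A aStar) ≤ 6 * d →
      δ ^ 2 * invSq (pullMatrix 1 A π) (proj A c - proj A aStar) ≤
        6 * d * inner ℝ θ (aStar - c) ^ 2 := by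
    intro c hc hcne hle
    have h3 : δ ^ 2 ≤ inner ℝ θ (aStar - c) ^ 2 := by gcongr; exact hgap c hc hcne
    rw [mul_comm]
    gcongr
  by_cases hr2 : 2 ≤ armRank A
  · exact conclude a ha hne (by linarith [invSq_pullMatrix_one_sub_le h hr2 ha hs])
  have hr1 : armRank A = 1 := by omega
  have hr1' : (armRank A : ℝ) = 1 := by exact_mod_cast hr1
  by_cases hd2 : 2 ≤ d
  · refine conclude a ha hne ?_
    have h1 := mul_invSq_pullMatrix_sub_le h one_pos ha hs
    have hd2' : (2 : ℝ) ≤ d := by exact_mod_cast hd2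
    push_cast at h1
    linarith
  have hd1 : d = 1 := by omega
  have hd1' : (d : ℝ) = 1 := by exact_mod_cast hd1
  -- An arm in the support is pulled at least once, so its form is at most 1 instead of 2; in
  -- dimension one the total is `2 + 4 = 6`.
  have support : ∀ c ∈ A, (0 < π c ∨ 0 < π aStar) →
      invSq (pullMatrix 1 A π) (proj A c - proj A aStar) ≤ 6 * d := by
    intro c hc hpos
    have h1 := invSq_pullMatrix_sub_le_of_pos h one_pos hc hs hpos
    linarith
  obtain ⟨c, hc, hcpos⟩ : ∃ c ∈ A, 0 < π c := by
    by_contra! hall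
    have h1 := Finset.sum_nonpos hall
    rw [h.1.2.1] at h1
    linarith
  by_cases hcs : c = aStar
  · exact conclude a ha hne (support a ha (Or.inr (hcs ▸ hcpos)))
  have hc' := conclude c hc hcs (support c hc (Or.inl hcpos))
  -- On a line, both sides of the claim scale by `t ^ 2`, so the bound for the supported arm `c`
  -- carries over to `a`.
  obtain ⟨t, ht⟩ : ∃ t : ℝ, t • (c - aStar) = a - aStar :=
    (finrank_eq_one_iff_of_nonzero' (c - aStar) (sub_ne_zero.2 hcs)).1
      (by rw [finrank_euclideanSpace_fin, hd1]) _
  have hx : proj A a - proj A aStar = t • (proj A c - proj A aStar) := by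
    rw [← proj_sub, ← ht, proj_smul, proj_sub]
  have hΔ : inner ℝ θ (aStar - a) = t * inner ℝ θ (aStar - c) := by
    rw [← neg_sub a, ← ht, ← smul_neg, neg_sub, inner_smul_right]
  rw [hx, invSq_smul, hΔ]
  nlinarith [mul_le_mul_of_nonneg_left hc' (sq_nonneg t)]

end Pulls

end Design

/-! ### General probability lemmas. -/

theorem _root_.ProbabilityTheory.HasSubgaussianMGF.mono {Ω : Type*} {mΩ : MeasurableSpace Ω}
    {μ : Measure Ω} {X : Ω → ℝ} {c c' : ℝ≥0} (h : HasSubgaussianMGF X c μ) (hc : c ≤ c') :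
    HasSubgaussianMGF X c' μ where
  integrable_exp_mul := h.integrable_exp_mul
  mgf_le t := (h.mgf_le t).trans (Real.exp_le_exp.2 (by gcongr))

/-- Markov's inequality for the number of events that occur. -/
theorem mul_measureReal_le_sum_of_le_card {Ω ι : Type*} [MeasurableSpace Ω] {μ : Measure Ω}
    [IsFiniteMeasure μ] {s : Finset ι} {E : ι → Set Ω} {B : Set Ω} {k : ℕ}
    (hE : ∀ i ∈ s, MeasurableSet (E i)) (hB : MeasurableSet B)
    (h : ∀ ω ∈ B, ∃ S ⊆ s, S.card = k ∧ ∀ i ∈ S, ω ∈ E i) :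
    k * μ.real B ≤ ∑ i ∈ s, μ.real (E i) := by
  have hint : ∀ i ∈ s, Integrable ((E i).indicator fun _ => (1 : ℝ)) μ := fun i hi =>
    (integrable_const 1).indicator (hE i hi)
  have h1 : ∑ i ∈ s, μ.real (E i) = ∫ ω, ∑ i ∈ s, (E i).indicator (fun _ => (1 : ℝ)) ω ∂μ := by
    rw [integral_finsetSum _ hint]
    exact Finset.sum_congr rfl fun i hi => by simp [integral_indicator_const _ (hE i hi)]
  have h2 : k * μ.real B = ∫ ω, B.indicator (fun _ => (k : ℝ)) ω ∂μ := by
    rw [integral_indicator_const _ hB, smul_eq_mul, mul_comm]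
  rw [h1, h2]
  refine integral_mono ((integrable_const _).indicator hB) (integrable_finsetSum _ hint) fun ω => ?_
  have hnn : ∀ i ∈ s, 0 ≤ (E i).indicator (fun _ => (1 : ℝ)) ω := fun i _ =>
    Set.indicator_nonneg (fun _ _ => zero_le_one) _
  by_cases hω : ω ∈ B
  · obtain ⟨S, hS, hcard, hmem⟩ := h ω hω
    simp only [Set.indicator_of_mem hω]
    calc (k : ℝ) = ∑ i ∈ S, (E i).indicator (fun _ => (1 : ℝ)) ω := by
          rw [Finset.sum_congr rfl fun i hi => Set.indicator_of_mem (hmem i hi) _]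
          simp [hcard]
      _ ≤ _ := Finset.sum_le_sum_of_subset_of_nonneg hS fun i hi _ => hnn i hi
  · simp only [Set.indicator_of_notMem hω]
    exact Finset.sum_nonneg hnn

/-! ### The least-squares error in one round with a fixed active set. -/

namespace Implementation

variable {d : ℕ} {𝒜 : Finset (Arm d)} {T M : ℕ} (I : Implementation 𝒜 T M)
  {A : Finset (Arm d)} {p : ℕ}

/-- The prescribed counts of the arms of `A` already add up to the length of the round, so no pull
is left for another arm. -/
theorem order_mem (hA : A ⊆ 𝒜) (hne : A.Nonempty) (m : Fin M) {s : ℕ}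
    (hs : s ∈ Finset.range (roundLength (roundBudget 𝒜.card T) A (I.design p A))) :
    I.order p A m s ∈ A := by
  classical
  set L := roundLength (roundBudget 𝒜.card T) A (I.design p A) with hL
  have hcard : ∀ a ∈ A, ((Finset.range L).filter fun s => I.order p A m s = a).card =
      pulls (roundBudget 𝒜.card T) (I.design p A) a := fun a ha => by
    rw [← I.order_spec p A hA hne m a ha, ← Set.ncard_coe_finset]
    congr 1
    ext s
    simp [hL]
  have hsub : (Finset.range L).filter (fun s => I.order p A m s ∈ A) ⊆ Finset.range L :=
    Finset.filter_subset _ _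
  have heq : (Finset.range L).filter (fun s => I.order p A m s ∈ A) = Finset.range L := by
    refine Finset.eq_of_subset_of_card_le hsub ?_
    have hfib := Finset.card_eq_sum_card_fiberwise (f := fun s => I.order p A m s) (t := A)
      (s := (Finset.range L).filter fun s => I.order p A m s ∈ A)
      (fun s hs => (Finset.mem_filter.1 hs).2)
    rw [hfib, Finset.card_range, hL, roundLength]
    refine Finset.sum_le_sum fun a ha => ?_
    rw [← hcard a ha]
    refine Finset.card_le_card fun s hs => ?_
    simp only [Finset.mem_filter] at hs ⊢
    exact ⟨⟨hs.1, hs.2 ▸ ha⟩, hs.2⟩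
  rw [← heq] at hs
  exact (Finset.mem_filter.1 hs).2

theorem sum_order (hA : A ⊆ 𝒜) (hne : A.Nonempty) (m : Fin M) (f : Arm d → ℝ) :
    ∑ s ∈ Finset.range (roundLength (roundBudget 𝒜.card T) A (I.design p A)),
      f (I.order p A m s) = ∑ a ∈ A, (I.numPulls p A a : ℝ) * f a := by
  classical
  rw [← Finset.sum_fiberwise_of_maps_to (fun s hs => I.order_mem hA hne m hs)]
  refine Finset.sum_congr rfl fun a ha => ?_
  rw [Finset.sum_congr rfl (g := fun _ => f a) (fun s hs => by rw [(Finset.mem_filter.1 hs).2]),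
    Finset.sum_const, nsmul_eq_mul, numPulls, ← I.order_spec p A hA hne m a ha,
    ← Set.ncard_coe_finset]
  congr 3
  ext s
  simp

/-- The matrix `V_S` of the server. -/
theorem sum_agentV : ∑ m, I.agentV p A m =
    (M : ℝ) • pullMatrix (roundBudget 𝒜.card T) A (I.design p A) := by
  simp [agentV, numPulls, Nat.cast_smul_eq_nsmul]

theorem serverMatrix_posDef (hA : A ⊆ 𝒜) (hne : A.Nonempty) (hM : 0 < M)
    (hb : 0 < roundBudget 𝒜.card T) : (∑ m, I.agentV p A m).PosDef := by
  rw [sum_agentV]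
  exact (pullMatrix_posDef (I.design_spec p A hA hne).1 hb).smul (by positivity)

theorem dotProduct_serverMatrix_mulVec (x y : Fin (armRank A) → ℝ) :
    x ⬝ᵥ ((∑ m, I.agentV p A m) *ᵥ y) =
      M * ∑ a ∈ A, (I.numPulls p A a : ℝ) * ((proj A a ⬝ᵥ x) * (proj A a ⬝ᵥ y)) := by
  rw [sum_agentV, smul_mulVec, dotProduct_smul, dotProduct_designMatrix_mulVec, smul_eq_mul]
  rfl

/-- The difference of the estimates of two arms is the true difference plus weighted noise. -/
theorem estimate_sub_estimate (hA : A ⊆ 𝒜) (hM : 0 < M) (hb : 0 < roundBudget 𝒜.card T)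
    (θ : Arm d) (h : Fin M → ℕ → ℕ → ℝ) {a a' : Arm d} (ha : a ∈ A) (ha' : a' ∈ A) :
    I.estimate θ h p A a - I.estimate θ h p A a' = inner ℝ θ (a - a') +
      ∑ m, ∑ s ∈ Finset.range (roundLength (roundBudget 𝒜.card T) A (I.design p A)),
        (proj A (I.order p A m s) ⬝ᵥ
          ((∑ m, I.agentV p A m)⁻¹ *ᵥ (proj A a - proj A a'))) * h m p s := by
  have hne : A.Nonempty := ⟨a, ha⟩
  have hV := I.serverMatrix_posDef (p := p) hA hne hM hb
  set V := ∑ m, I.agentV p A m with hVdef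
  set x := proj A a - proj A a' with hx
  set y := V⁻¹ *ᵥ x with hy
  have hVt : (V⁻¹)ᵀ = V⁻¹ := by simpa using hV.inv.isHermitian.eq
  have h1 : I.estimate θ h p A a - I.estimate θ h p A a' = (∑ m, I.agentD θ h p A m) ⬝ᵥ y := by
    rw [estimate, estimate, ← dotProduct_sub, thetaHat, hy, dotProduct_mulVec, ← mulVec_transpose,
      hVt]
  have h2 : ∑ m : Fin M, ∑ s ∈ Finset.range
      (roundLength (roundBudget 𝒜.card T) A (I.design p A)),
      inner ℝ θ (I.order p A m s) * (proj A (I.order p A m s) ⬝ᵥ y) = inner ℝ θ (a - a') := by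
    have hsub : a - a' ∈ armSpan A :=
      sub_mem (Submodule.subset_span ha) (Submodule.subset_span ha')
    rw [← proj_dotProduct_proj θ hsub, proj_sub, ← hx, ← mulVec_inv_mulVec hV x, ← hy, hVdef,
      dotProduct_serverMatrix_mulVec]
    simp only [I.sum_order hA hne _ fun o => inner ℝ θ o * (proj A o ⬝ᵥ y), Finset.sum_const,
      Finset.card_univ, Fintype.card_fin, nsmul_eq_mul]
    congr 1
    refine Finset.sum_congr rfl fun c hc => ?_
    rw [← proj_dotProduct_proj θ (Submodule.subset_span hc), dotProduct_comm (proj A θ)]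
  rw [h1, ← h2, ← Finset.sum_add_distrib, sum_dotProduct]
  refine Finset.sum_congr rfl fun m _ => ?_
  rw [agentD, sum_dotProduct, ← Finset.sum_add_distrib]
  refine Finset.sum_congr rfl fun s _ => ?_
  rw [smul_dotProduct, smul_eq_mul, reward]
  ring

/-- The squares add up to `xᵀ V⁻¹ V V⁻¹ x` for the server matrix `V`, which is `M` times the matrix
of one agent. -/
theorem sum_noiseWeight_sq (hA : A ⊆ 𝒜) (hne : A.Nonempty) (hM : 0 < M)
    (hb : 0 < roundBudget 𝒜.card T) (x : Fin (armRank A) → ℝ) :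
    ∑ m, ∑ s ∈ Finset.range (roundLength (roundBudget 𝒜.card T) A (I.design p A)),
      (proj A (I.order p A m s) ⬝ᵥ ((∑ m, I.agentV p A m)⁻¹ *ᵥ x)) ^ 2 =
    (M : ℝ)⁻¹ * invSq (pullMatrix (roundBudget 𝒜.card T) A (I.design p A)) x := by
  have hV := I.serverMatrix_posDef (p := p) hA hne hM hb
  have hM' : (M : ℝ) ≠ 0 := by positivity
  rw [← invSq_const_smul _ _ (pullMatrix_posDef (I.design_spec p A hA hne).1 hb) hM',
    ← I.sum_agentV]
  set V := ∑ m, I.agentV p A m with hVdef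
  set y := V⁻¹ *ᵥ x with hy
  have hq : invSq V x = y ⬝ᵥ (V *ᵥ y) := by rw [mulVec_inv_mulVec hV, invSq, dotProduct_comm]
  rw [hq, hVdef, dotProduct_serverMatrix_mulVec]
  simp only [I.sum_order hA hne _ fun o => (proj A o ⬝ᵥ y) ^ 2, Finset.sum_const,
    Finset.card_univ, Fintype.card_fin, nsmul_eq_mul]
  simp only [pow_two]

section Probability

variable {Ω : Type*} {mΩ : MeasurableSpace Ω} {μ : Measure Ω} {η : Fin M → ℕ → ℕ → Ω → ℝ}
  {θ aStar : Arm d} {R : ℝ≥0}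

theorem hasSubgaussianMGF_noise (hindep : iIndepFun (fun k : Fin M × ℕ × ℕ => η k.1 k.2.1 k.2.2) μ)
    (hsub : ∀ m p s, HasSubgaussianMGF (η m p s) (R ^ 2) μ) (p L : ℕ) (c : Fin M → ℕ → ℝ)
    {Q : ℝ≥0} (hQ : ∑ m, ∑ s ∈ Finset.range L, c m s ^ 2 ≤ Q) :
    HasSubgaussianMGF (fun ω => ∑ m, ∑ s ∈ Finset.range L, c m s * η m p s ω) (Q * R ^ 2) μ := by
  have hinj : Function.Injective fun k : Fin M × ℕ => (k.1, p, k.2) := by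
    rintro ⟨m, s⟩ ⟨m', s'⟩ h
    simpa using h
  have h1 : iIndepFun (fun (k : Fin M × ℕ) ω => c k.1 k.2 * η k.1 p k.2 ω) μ :=
    (hindep.precomp hinj).comp (fun k x => c k.1 k.2 * x) fun k => measurable_const_mul _
  have h0 : ∀ m s, HasSubgaussianMGF (fun ω => c m s * η m p s ω)
      (Real.toNNReal (c m s ^ 2) * R ^ 2) μ := fun m s => by
    rw [Real.toNNReal_of_nonneg (sq_nonneg _)]
    exact (hsub m p s).const_mul (c m s)
  have h2 := HasSubgaussianMGF.sum_of_iIndepFun h1 (s := Finset.univ ×ˢ Finset.range L)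
    fun k _ => h0 k.1 k.2
  simp only [Finset.sum_product] at h2
  refine h2.mono ?_
  rw [← NNReal.coe_le_coe]
  push_cast
  simp only [Real.coe_toNNReal _ (sq_nonneg _), ← Finset.sum_mul]
  exact mul_le_mul_of_nonneg_right hQ (by positivity)

theorem measureReal_estimate_le (hA : A ⊆ 𝒜) (hM : 0 < M) (hb : 0 < roundBudget 𝒜.card T)
    (hR : 0 < R) (hindep : iIndepFun (fun k : Fin M × ℕ × ℕ => η k.1 k.2.1 k.2.2) μ)
    (hsub : ∀ m p s, HasSubgaussianMGF (η m p s) (R ^ 2) μ) {a : Arm d} (ha : a ∈ A)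
    (hs : aStar ∈ A) {δ β : ℝ} (hδ : 0 < δ) (hβ : 0 < β) (hgap : 0 < inner ℝ θ (aStar - a))
    (hle : δ ^ 2 * invSq (pullMatrix (roundBudget 𝒜.card T) A (I.design p A))
      (proj A a - proj A aStar) ≤ β * inner ℝ θ (aStar - a) ^ 2) :
    μ.real {ω | I.estimate θ (fun m p s => η m p s ω) p A aStar ≤
      I.estimate θ (fun m p s => η m p s ω) p A a} ≤
      Real.exp (-(M * δ ^ 2) / (2 * R ^ 2 * β)) := by
  have hne : A.Nonempty := ⟨a, ha⟩
  set Δ : ℝ := inner ℝ θ (aStar - a) with hΔ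
  set x := proj A a - proj A aStar with hx
  have hM' : (0 : ℝ) < M := by exact_mod_cast hM
  have hR' : (0 : ℝ) < R := hR
  -- Proportional to `Δ ^ 2`, so that the gap of the individual arm cancels in the tail exponent.
  set Q : ℝ≥0 := ⟨(M : ℝ)⁻¹ * (β * Δ ^ 2 / δ ^ 2), by positivity⟩ with hQdef
  have hQ : ∑ m, ∑ s ∈ Finset.range (roundLength (roundBudget 𝒜.card T) A (I.design p A)),
      (proj A (I.order p A m s) ⬝ᵥ ((∑ m, I.agentV p A m)⁻¹ *ᵥ x)) ^ 2 ≤ Q := by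
    rw [I.sum_noiseWeight_sq hA hne hM hb]
    refine mul_le_mul_of_nonneg_left ?_ (by positivity)
    rw [le_div_iff₀ (by positivity)]
    linarith
  have htail := (hasSubgaussianMGF_noise hindep hsub p _ _ hQ).measure_ge_le hgap.le
  have hset : {ω | I.estimate θ (fun m p s => η m p s ω) p A aStar ≤
      I.estimate θ (fun m p s => η m p s ω) p A a} = {ω | Δ ≤ ∑ m, ∑ s ∈ Finset.range
        (roundLength (roundBudget 𝒜.card T) A (I.design p A)),
        (proj A (I.order p A m s) ⬝ᵥ ((∑ m, I.agentV p A m)⁻¹ *ᵥ x)) * η m p s ω} := by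
    ext ω
    have h := I.estimate_sub_estimate (p := p) hA hM hb θ (fun m p s => η m p s ω) ha hs
    rw [← neg_sub aStar a, inner_neg_right, ← hΔ, ← hx] at h
    simp only [Set.mem_ofPred_eq]
    constructor <;> intro h' <;> linarith
  rw [hset]
  refine htail.trans_eq ?_
  congr 1
  have hQc : (Q : ℝ) = (M : ℝ)⁻¹ * (β * Δ ^ 2 / δ ^ 2) := rfl
  push_cast
  rw [hQc]
  field_simp

end Probability

end Implementation

/-! ### Arithmetic of halving, the gap and the round budget. -/

theorem numActive_zero (K : ℕ) : numActive K 0 = K := by simp [numActive]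

theorem numActive_le_two_mul (K p : ℕ) : numActive K p ≤ 2 * numActive K (p + 1) := by
  refine Nat.ceil_le.2 ?_
  have h := Nat.le_ceil ((K : ℝ) / 2 ^ (p + 1))
  have h2 : (K : ℝ) / 2 ^ p = 2 * ((K : ℝ) / 2 ^ (p + 1)) := by
    rw [pow_succ]
    field_simp
  rw [h2]
  push_cast
  exact mul_le_mul_of_nonneg_left h (by norm_num)

theorem numActive_pos {K : ℕ} (hK : 0 < K) (p : ℕ) : 0 < numActive K p :=
  Nat.ceil_pos.2 (by positivity)

theorem numActive_numRounds {K : ℕ} (hK : 0 < K) : numActive K (numRounds K) = 1 := by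
  refine le_antisymm (Nat.ceil_le.2 ?_) (numActive_pos hK _)
  rw [Nat.cast_one, div_le_one (by positivity), ← Real.rpow_natCast,
    ← Real.logb_le_iff_le_rpow (by norm_num) (by exact_mod_cast hK)]
  exact Nat.le_ceil _

section Gap

variable {d : ℕ} {𝒜 : Finset (Arm d)} {θ aStar : Arm d}

theorem finite_suboptimal (𝒜 : Finset (Arm d)) (aStar : Arm d) :
    Finite {a : Arm d // a ∈ 𝒜 ∧ a ≠ aStar} :=
  (𝒜.finite_toSet.subset fun _ h => h.1 : {a : Arm d | a ∈ 𝒜 ∧ a ≠ aStar}.Finite)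

theorem minGap_le {a : Arm d} (ha : a ∈ 𝒜) (hne : a ≠ aStar) :
    minGap θ 𝒜 aStar ≤ inner ℝ θ (aStar - a) := by
  have := finite_suboptimal 𝒜 aStar
  exact ciInf_le (f := fun a : {a : Arm d // a ∈ 𝒜 ∧ a ≠ aStar} => inner ℝ θ (aStar - a.1))
    (Set.finite_range _).bddBelow ⟨a, ha, hne⟩

theorem minGap_pos (hK : 2 ≤ 𝒜.card)
    (hbest : ∀ a ∈ 𝒜, a ≠ aStar → inner ℝ θ a < inner ℝ θ aStar) : 0 < minGap θ 𝒜 aStar := by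
  have := finite_suboptimal 𝒜 aStar
  obtain ⟨c, hc, hne⟩ := Finset.exists_mem_ne (s := 𝒜) (by omega) aStar
  have : Nonempty {a : Arm d // a ∈ 𝒜 ∧ a ≠ aStar} := ⟨⟨c, hc, hne⟩⟩
  obtain ⟨⟨a, ha, hane⟩, h⟩ := exists_eq_ciInf_of_finite
    (f := fun a : {a : Arm d // a ∈ 𝒜 ∧ a ≠ aStar} => inner ℝ θ (aStar - a.1))
  rw [minGap, ← h, inner_sub_right]
  linarith [hbest a ha hane]

end Gap

section Budget

variable {K T : ℕ}

theorem one_le_logb (hK : 2 ≤ K) : 1 ≤ Real.logb 2 K := by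
  rw [Real.le_logb_iff_rpow_le (by norm_num) (by positivity), Real.rpow_one]
  exact_mod_cast hK

theorem numRounds_pos (hK : 2 ≤ K) : 0 < numRounds K :=
  Nat.ceil_pos.2 (one_pos.trans_le (one_le_logb hK))

theorem roundBudget_pos (hK : 2 ≤ K) (hT : numRounds K ≤ T) : 0 < roundBudget K T :=
  Nat.div_pos hT (numRounds_pos hK)

theorem numRounds_lt_logb_add_one (hK : 2 ≤ K) : (numRounds K : ℝ) < Real.logb 2 K + 1 :=
  Nat.ceil_lt_add_one (zero_le_one.trans (one_le_logb hK))

/-- This is `2 ^ 3 ≤ 3 ^ 2`. It is needed when there are two rounds, where `⌈log K⌉ < log K + 1`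
alone is too weak. -/
theorem three_halves_le_logb (hK : 3 ≤ K) : 3 / 2 ≤ Real.logb 2 K := by
  have h3 : Real.logb 2 3 ≤ Real.logb 2 K :=
    Real.logb_le_logb_of_le (by norm_num) (by norm_num) (by exact_mod_cast hK)
  have h8 : (3 : ℝ) ≤ 2 * Real.logb 2 3 := by
    have h1 : Real.logb 2 ((2 : ℝ) ^ 3) ≤ Real.logb 2 ((3 : ℝ) ^ 2) :=
      Real.logb_le_logb_of_le (by norm_num) (by norm_num) (by norm_num)
    rw [Real.logb_pow, Real.logb_pow, Real.logb_self_eq_one (by norm_num)] at h1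
    push_cast at h1
    linarith
  linarith

theorem numRounds_two : numRounds 2 = 1 := by
  simp [numRounds]

theorem budget_add_one_le (hK : 2 ≤ K) :
    (T : ℝ) + 1 ≤ (roundBudget K T + 1) * numRounds K := by
  have h : T < numRounds K * (T / numRounds K + 1) := Nat.lt_mul_div_succ T (numRounds_pos hK)
  have h2 : T + 1 ≤ (roundBudget K T + 1) * numRounds K := by
    rw [roundBudget, mul_comm]
    exact h
  exact_mod_cast h2

theorem budget_le_of_two_le (hK : 2 ≤ K) (hb : 2 ≤ roundBudget K T) :
    (T : ℝ) ≤ 2 * roundBudget K T * Real.logb 2 K := by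
  have hT := budget_add_one_le (T := T) hK
  have hn := numRounds_lt_logb_add_one hK
  have hl := one_le_logb hK
  have hb' : (2 : ℝ) ≤ roundBudget K T := by exact_mod_cast hb
  rcases hK.eq_or_lt with rfl | hK3
  · rw [numRounds_two] at hT
    push_cast at hT hl ⊢
    nlinarith
  have hl3 := three_halves_le_logb hK3
  rcases le_or_gt (numRounds K) 2 with h2 | h2
  · have h2' : (numRounds K : ℝ) ≤ 2 := by exact_mod_cast h2
    nlinarith
  · have h2' : (3 : ℝ) ≤ numRounds K := by exact_mod_cast h2
    nlinarith

theorem budget_le_of_eq_one (hK : 2 ≤ K) (hb : roundBudget K T = 1) :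
    3 * (T : ℝ) ≤ 8 * Real.logb 2 K := by
  have hT := budget_add_one_le (T := T) hK
  have hn := numRounds_lt_logb_add_one hK
  have hl := one_le_logb hK
  rw [hb] at hT
  push_cast at hT
  rcases hK.eq_or_lt with rfl | hK3
  · rw [numRounds_two] at hT
    push_cast at hT hl ⊢
    linarith
  have hl3 := three_halves_le_logb hK3
  rcases le_or_gt (numRounds K) 2 with h2 | h2
  · have h2' : (numRounds K : ℝ) ≤ 2 := by exact_mod_cast h2
    linarith
  · have h2' : (3 : ℝ) ≤ numRounds K := by exact_mod_cast h2
    linarith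

end Budget

/-! ### Elimination of the best arm: measurability, independence, union bound. -/

namespace Implementation

variable {d : ℕ} {𝒜 : Finset (Arm d)} {T M : ℕ} (I : Implementation 𝒜 T M)
  {A : Finset (Arm d)} {p : ℕ}

theorem active_subset_and_card (θ : Arm d) (h : Fin M → ℕ → ℕ → ℝ) (p : ℕ) :
    I.active θ h p ⊆ 𝒜 ∧ (I.active θ h p).card = numActive 𝒜.card p := by
  induction p with
  | zero => exact ⟨subset_rfl, (numActive_zero _).symm⟩
  | succ p ih =>
    have hs := I.select_spec p _ (I.estimate θ h p (I.active θ h p)) ih.1 ih.2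
    exact ⟨hs.1.trans ih.1, hs.2.1⟩

section Probability

variable {Ω : Type*} {η : Fin M → ℕ → ℕ → Ω → ℝ} {θ aStar : Arm d}

theorem measurable_estimate {mΩ : MeasurableSpace Ω} (hη : ∀ m s, Measurable (η m p s)) :
    Measurable fun ω => I.estimate θ (fun m p s => η m p s ω) p A := by
  refine measurable_pi_iff.2 fun a => ?_
  simp only [estimate, thetaHat, agentD, reward, dotProduct, mulVec, Finset.sum_apply,
    Pi.smul_apply, smul_eq_mul]
  fun_prop

theorem measurableSet_select {mΩ : MeasurableSpace Ω} (hη : ∀ m s, Measurable (η m p s))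
    (S : Finset (Arm d)) :
    MeasurableSet {ω | I.select p A (I.estimate θ (fun m p s => η m p s ω) p A) = S} :=
  I.measurable_estimate hη (I.select_meas p A S)

/-- The σ-algebra is arbitrary and only noise of rounds before `p` must be measurable, so this
applies to the σ-algebra generated by the past noise. -/
theorem measurableSet_active {mΩ : MeasurableSpace Ω} (p : ℕ)
    (hη : ∀ m q s, q < p → Measurable (η m q s)) (A : Finset (Arm d)) :
    MeasurableSet {ω | I.active θ (fun m p s => η m p s ω) p = A} := by
  induction p generalizing A with
  | zero =>
    simp only [active]
    exact MeasurableSet.const _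
  | succ p ih =>
    have hset : {ω | I.active θ (fun m p s => η m p s ω) (p + 1) = A} =
        ⋃ B ∈ 𝒜.powerset, {ω | I.active θ (fun m p s => η m p s ω) p = B} ∩
          {ω | I.select p B (I.estimate θ (fun m p s => η m p s ω) p B) = A} := by
      ext ω
      simp only [Set.mem_iUnion, Set.mem_inter_iff, Set.mem_ofPred_eq, Finset.mem_powerset,
        exists_prop]
      constructor
      · intro h
        exact ⟨_, (I.active_subset_and_card θ _ p).1, rfl, h⟩
      · rintro ⟨B, -, rfl, h⟩
        exact h
    rw [hset]
    refine Finset.measurableSet_biUnion _ fun B _ => ?_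
    exact (ih (fun m q s hq => hη m q s (by omega)) B).inter
      (I.measurableSet_select (fun m s => hη m p s (by omega)) A)

theorem measurableSet_notMem_select {mΩ : MeasurableSpace Ω}
    (hη : ∀ m s, Measurable (η m p s)) (hA : A ⊆ 𝒜) (hcard : A.card = numActive 𝒜.card p) :
    MeasurableSet {ω | aStar ∉ I.select p A (I.estimate θ (fun m p s => η m p s ω) p A)} := by
  classical
  have hset : {ω | aStar ∉ I.select p A (I.estimate θ (fun m p s => η m p s ω) p A)} =
      ⋃ S ∈ A.powerset.filter (aStar ∉ ·),
        {ω | I.select p A (I.estimate θ (fun m p s => η m p s ω) p A) = S} := by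
    ext ω
    simp only [Set.mem_iUnion, Set.mem_ofPred_eq, Finset.mem_filter, Finset.mem_powerset,
      exists_prop]
    constructor
    · intro h
      exact ⟨_, ⟨(I.select_spec p A _ hA hcard).1, h⟩, rfl⟩
    · rintro ⟨S, ⟨-, h⟩, rfl⟩
      exact h
  rw [hset]
  exact Finset.measurableSet_biUnion _ fun S _ => I.measurableSet_select hη S

variable {mΩ : MeasurableSpace Ω} {μ : Measure Ω}

/-- The active set of a round is independent of the noise of that round. -/
theorem measureReal_active_inter (hmeas : ∀ m p s, Measurable (η m p s))
    (hindep : iIndepFun (fun k : Fin M × ℕ × ℕ => η k.1 k.2.1 k.2.2) μ)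
    (hA : A ⊆ 𝒜) (hcard : A.card = numActive 𝒜.card p) :
    μ.real ({ω | I.active θ (fun m p s => η m p s ω) p = A} ∩
      {ω | aStar ∉ I.select p A (I.estimate θ (fun m p s => η m p s ω) p A)}) =
    μ.real {ω | I.active θ (fun m p s => η m p s ω) p = A} *
      μ.real {ω | aStar ∉ I.select p A (I.estimate θ (fun m p s => η m p s ω) p A)} := by
  set σ : Fin M × ℕ × ℕ → MeasurableSpace Ω := fun k =>
    MeasurableSpace.comap (η k.1 k.2.1 k.2.2) inferInstance with hσ
  have hle : ∀ k, σ k ≤ mΩ := fun k => (hmeas _ _ _).comap_le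
  have hdisj : Disjoint {k : Fin M × ℕ × ℕ | k.2.1 < p} {k | k.2.1 = p} :=
    Set.disjoint_left.2 fun k (h1 : k.2.1 < p) (h2 : k.2.1 = p) => by omega
  have hind := indep_iSup_of_disjoint hle hindep hdisj
  have hcoord : ∀ (S : Set (Fin M × ℕ × ℕ)) k, k ∈ S →
      Measurable[⨆ i ∈ S, σ i] (η k.1 k.2.1 k.2.2) := fun S k hk =>
    (comap_measurable (η k.1 k.2.1 k.2.2)).mono (le_iSup₂_of_le k hk le_rfl) le_rfl
  have h1 := I.measurableSet_active (θ := θ) (η := η)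
    (mΩ := ⨆ i ∈ {k : Fin M × ℕ × ℕ | k.2.1 < p}, σ i) p
    (fun m q s hq => hcoord _ (m, q, s) hq) A
  have h2 := I.measurableSet_notMem_select (θ := θ) (η := η) (aStar := aStar)
    (mΩ := ⨆ i ∈ {k : Fin M × ℕ × ℕ | k.2.1 = p}, σ i)
    (fun m s => hcoord _ (m, p, s) rfl) hA hcard
  have h3 := (Indep_iff _ _ μ).1 hind _ _ h1 h2
  rw [Measure.real, h3, ENNReal.toReal_mul]
  rfl

theorem measureReal_notMem_select_le [IsProbabilityMeasure μ]
    (hmeas : ∀ m p s, Measurable (η m p s)) (hA : A ⊆ 𝒜)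
    (hcard : A.card = numActive 𝒜.card p) (hs : aStar ∈ A) {E : ℝ} (hE : 0 ≤ E)
    (hpair : ∀ a ∈ A, a ≠ aStar →
      μ.real {ω | I.estimate θ (fun m p s => η m p s ω) p A aStar ≤
        I.estimate θ (fun m p s => η m p s ω) p A a} ≤ E) :
    μ.real {ω | aStar ∉ I.select p A (I.estimate θ (fun m p s => η m p s ω) p A)} ≤ 2 * E := by
  classical
  have hest := fun a => (measurable_pi_iff.1
    (I.measurable_estimate (θ := θ) (A := A) (fun m s => hmeas m p s))) a
  have hmarkov := mul_measureReal_le_sum_of_le_card (μ := μ) (s := A.erase aStar)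
    (E := fun a => {ω | I.estimate θ (fun m p s => η m p s ω) p A aStar ≤
        I.estimate θ (fun m p s => η m p s ω) p A a})
    (k := numActive 𝒜.card (p + 1))
    (fun a _ => measurableSet_le (hest aStar) (hest a))
    (I.measurableSet_notMem_select (θ := θ) (aStar := aStar) (fun m s => hmeas m p s) hA hcard)
    -- When `aStar` is dropped, the selected set itself is a family of arms that all overtake it.
    (fun ω hω => by
      obtain ⟨h1, h2, h3⟩ := I.select_spec p A
        (I.estimate θ (fun m p s => η m p s ω) p A) hA hcard
      refine ⟨_, fun a ha => Finset.mem_erase.2 ⟨?_, h1 ha⟩, h2, fun a ha => h3 a ha _ hs hω⟩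
      rintro rfl
      exact hω ha)
  have hsum : ∑ a ∈ A.erase aStar, μ.real {ω | I.estimate θ (fun m p s => η m p s ω) p A aStar ≤
        I.estimate θ (fun m p s => η m p s ω) p A a} ≤ A.card * E := by
    refine (Finset.sum_le_card_nsmul _ _ E fun a ha =>
      hpair a (Finset.mem_of_mem_erase ha) (Finset.ne_of_mem_erase ha)).trans ?_
    rw [nsmul_eq_mul]
    gcongr
    exact Finset.erase_subset _ _
  have hk : (A.card : ℝ) ≤ 2 * numActive 𝒜.card (p + 1) := by
    rw [hcard]
    exact_mod_cast numActive_le_two_mul _ _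
  have hkpos : (0 : ℝ) < numActive 𝒜.card (p + 1) := by
    exact_mod_cast numActive_pos (Finset.card_pos.2 ⟨aStar, hA hs⟩) _
  refine le_of_mul_le_mul_left ?_ hkpos
  nlinarith

theorem measureReal_eliminated_le [IsProbabilityMeasure μ]
    (hmeas : ∀ m p s, Measurable (η m p s))
    (hindep : iIndepFun (fun k : Fin M × ℕ × ℕ => η k.1 k.2.1 k.2.2) μ) {E : ℝ} (hE : 0 ≤ E)
    (hpair : ∀ A ⊆ 𝒜, aStar ∈ A → ∀ a ∈ A, a ≠ aStar →
      μ.real {ω | I.estimate θ (fun m p s => η m p s ω) p A aStar ≤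
        I.estimate θ (fun m p s => η m p s ω) p A a} ≤ E) :
    μ.real {ω | aStar ∈ I.active θ (fun m p s => η m p s ω) p ∧
      aStar ∉ I.active θ (fun m p s => η m p s ω) (p + 1)} ≤ 2 * E := by
  classical
  set F := 𝒜.powerset.filter fun A => aStar ∈ A ∧ A.card = numActive 𝒜.card p
  have hsub : {ω | aStar ∈ I.active θ (fun m p s => η m p s ω) p ∧
      aStar ∉ I.active θ (fun m p s => η m p s ω) (p + 1)} ⊆
      ⋃ A ∈ F, {ω | I.active θ (fun m p s => η m p s ω) p = A} ∩
        {ω | aStar ∉ I.select p A (I.estimate θ (fun m p s => η m p s ω) p A)} := by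
    rintro ω ⟨h1, h2⟩
    have hact := I.active_subset_and_card θ (fun m p s => η m p s ω) p
    exact Set.mem_biUnion (Finset.mem_filter.2 ⟨Finset.mem_powerset.2 hact.1, h1, hact.2⟩)
      ⟨rfl, h2⟩
  have hmact : ∀ A, MeasurableSet {ω | I.active θ (fun m p s => η m p s ω) p = A} := fun A =>
    I.measurableSet_active p (fun m q s _ => hmeas m q s) A
  calc _ ≤ μ.real (⋃ A ∈ F, {ω | I.active θ (fun m p s => η m p s ω) p = A} ∩
        {ω | aStar ∉ I.select p A (I.estimate θ (fun m p s => η m p s ω) p A)}) :=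
        measureReal_mono hsub (measure_ne_top _ _)
    _ ≤ ∑ A ∈ F, μ.real ({ω | I.active θ (fun m p s => η m p s ω) p = A} ∩
        {ω | aStar ∉ I.select p A (I.estimate θ (fun m p s => η m p s ω) p A)}) :=
        measureReal_biUnion_finset_le _ _
    _ ≤ ∑ A ∈ F, μ.real {ω | I.active θ (fun m p s => η m p s ω) p = A} * (2 * E) := by
        refine Finset.sum_le_sum fun A hA => ?_
        obtain ⟨hA𝒜, hs, hcard⟩ := Finset.mem_filter.1 hA
        rw [Finset.mem_powerset] at hA𝒜
        rw [I.measureReal_active_inter hmeas hindep hA𝒜 hcard]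
        exact mul_le_mul_of_nonneg_left
          (I.measureReal_notMem_select_le hmeas hA𝒜 hcard hs hE (hpair A hA𝒜 hs))
          measureReal_nonneg
    -- The events for different `A` are disjoint, so their probabilities add up to at most 1 and the
    -- number of possible sets does not enter.
    _ = μ.real (⋃ A ∈ F, {ω | I.active θ (fun m p s => η m p s ω) p = A}) * (2 * E) := by
        rw [← Finset.sum_mul, measureReal_biUnion_finset _ fun A _ => hmact A]
        intro A _ B _ hAB
        exact Set.disjoint_left.2 fun ω h1 h2 => hAB (h1.symm.trans h2)
    _ ≤ 1 * (2 * E) := mul_le_mul_of_nonneg_right measureReal_le_one (by positivity)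
    _ = 2 * E := one_mul _

theorem measureReal_not_outputs_le [IsProbabilityMeasure μ] (hmem : aStar ∈ 𝒜)
    (hmeas : ∀ m p s, Measurable (η m p s))
    (hindep : iIndepFun (fun k : Fin M × ℕ × ℕ => η k.1 k.2.1 k.2.2) μ) {E : ℝ} (hE : 0 ≤ E)
    (hpair : ∀ p, ∀ A ⊆ 𝒜, aStar ∈ A → ∀ a ∈ A, a ≠ aStar →
      μ.real {ω | I.estimate θ (fun m p s => η m p s ω) p A aStar ≤
        I.estimate θ (fun m p s => η m p s ω) p A a} ≤ E) :
    μ.real {ω | ¬ I.Outputs θ (fun m p s => η m p s ω) aStar} ≤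
      2 * numRounds 𝒜.card * E := by
  have hsub : {ω | ¬ I.Outputs θ (fun m p s => η m p s ω) aStar} ⊆
      ⋃ p ∈ Finset.range (numRounds 𝒜.card),
        {ω | aStar ∈ I.active θ (fun m p s => η m p s ω) p ∧
          aStar ∉ I.active θ (fun m p s => η m p s ω) (p + 1)} := by
    intro ω hω
    by_contra hnot
    simp only [Set.mem_iUnion, Set.mem_ofPred_eq, Finset.mem_range, exists_prop, not_exists,
      not_and, not_not] at hnot
    refine hω ?_
    have hin : ∀ p ≤ numRounds 𝒜.card, aStar ∈ I.active θ (fun m p s => η m p s ω) p := by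
      intro p
      induction p with
      | zero => exact fun _ => hmem
      | succ p ih => exact fun hp => hnot p (by omega) (ih (by omega))
    have hcard := (I.active_subset_and_card θ (fun m p s => η m p s ω) (numRounds 𝒜.card)).2
    rw [numActive_numRounds (Finset.card_pos.2 ⟨aStar, hmem⟩), Finset.card_eq_one] at hcard
    obtain ⟨a, ha⟩ := hcard
    have hlast := hin _ le_rfl
    rw [ha, Finset.mem_singleton] at hlast
    rw [Outputs, ha, hlast]
  calc _ ≤ _ := measureReal_mono hsub (measure_ne_top _ _)
    _ ≤ _ := measureReal_biUnion_finset_le _ _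
    _ ≤ _ := Finset.sum_le_card_nsmul _ _ (2 * E) fun p _ =>
        I.measureReal_eliminated_le hmeas hindep hE (hpair p)
    _ = _ := by
        rw [Finset.card_range, nsmul_eq_mul]
        ring

end Probability

/-- The confidence width constant of a round: `β` bounds the inverse signal-to-noise ratio of all
pairs of arms, and is small enough for the budget. -/
theorem exists_width (hK : 2 ≤ 𝒜.card) (hT : numRounds 𝒜.card ≤ T) (hd : 0 < d)
    {θ aStar : Arm d} {δ : ℝ} (hδ : 0 ≤ δ)
    (hgap : ∀ c ∈ 𝒜, c ≠ aStar → δ ≤ inner ℝ θ (aStar - c)) :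
    ∃ β : ℝ, 0 < β ∧ T * β ≤ 16 * d * Real.logb 2 𝒜.card ∧
      ∀ p, ∀ A ⊆ 𝒜, aStar ∈ A → ∀ a ∈ A, a ≠ aStar →
        δ ^ 2 * invSq (pullMatrix (roundBudget 𝒜.card T) A (I.design p A))
          (proj A a - proj A aStar) ≤ β * inner ℝ θ (aStar - a) ^ 2 := by
  have hb := roundBudget_pos hK hT
  have hd' : (0 : ℝ) < d := by exact_mod_cast hd
  have hb' : (0 : ℝ) < roundBudget 𝒜.card T := by exact_mod_cast hb
  rcases (Nat.succ_le_of_lt hb).eq_or_lt with hb1 | hb2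
  · have hb1 : roundBudget 𝒜.card T = 1 := hb1.symm
    refine ⟨6 * d, by positivity, ?_, fun p A hA hs a ha hne => ?_⟩
    · nlinarith [budget_le_of_eq_one hK hb1]
    · rw [hb1]
      exact sq_mul_invSq_pullMatrix_one_le (I.design_spec p A hA ⟨a, ha⟩) hδ
        (fun c hc => hgap c (hA hc)) hs ha hne
  · refine ⟨8 * d / roundBudget 𝒜.card T, by positivity, ?_, fun p A hA hs a ha hne => ?_⟩
    · rw [mul_div_assoc', div_le_iff₀ hb']
      nlinarith [budget_le_of_two_le hK hb2]
    · exact sq_mul_invSq_pullMatrix_le (I.design_spec p A hA ⟨a, ha⟩) hb hδ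
        (fun c hc => hgap c (hA hc)) hs ha hne

end Implementation

end MaLinBAI

theorem theorem1 {Ω : Type*} [MeasurableSpace Ω] (μ : Measure Ω) [IsProbabilityMeasure μ]
    {d : ℕ} (𝒜 : Finset (MaLinBAI.Arm d)) (hK : 2 ≤ 𝒜.card)
    (θ aStar : MaLinBAI.Arm d) (hmem : aStar ∈ 𝒜)
    (hbest : ∀ a ∈ 𝒜, a ≠ aStar → inner ℝ θ a < inner ℝ θ aStar)
    (M T : ℕ) (hT : MaLinBAI.numRounds 𝒜.card ≤ T)
    (I : MaLinBAI.Implementation 𝒜 T M)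
    (R : ℝ≥0) (hR : 0 < R)
    (η : Fin M → ℕ → ℕ → Ω → ℝ)
    (hmeas : ∀ m p s, Measurable (η m p s))
    (hindep : iIndepFun (fun k : Fin M × ℕ × ℕ => η k.1 k.2.1 k.2.2) μ)
    (hsub : ∀ m p s, HasSubgaussianMGF (η m p s) (R ^ 2) μ) :
    μ.real {ω | ¬ I.Outputs θ (fun m p s => η m p s ω) aStar} ≤
      4 * Real.logb 2 𝒜.card *
        Real.exp (-((T : ℝ) * M * MaLinBAI.minGap θ 𝒜 aStar ^ 2) /
          (32 * (R : ℝ) ^ 2 * d * Real.logb 2 𝒜.card)) := by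
  have hl := MaLinBAI.one_le_logb hK
  rcases M.eq_zero_or_pos with rfl | hM
  -- Without agents the exponential is 1 and the claimed bound is at least 4.
  · refine measureReal_le_one.trans ?_
    simp only [Nat.cast_zero, mul_zero, zero_mul, neg_zero, zero_div, Real.exp_zero, mul_one]
    linarith
  have hd : 0 < d := by
    rcases d.eq_zero_or_pos with rfl | hd
    · have := Finset.card_le_one_of_subsingleton 𝒜
      omega
    · exact hd
  have hδ := MaLinBAI.minGap_pos hK hbest
  have hgap : ∀ c ∈ 𝒜, c ≠ aStar → MaLinBAI.minGap θ 𝒜 aStar ≤ inner ℝ θ (aStar - c) :=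
    fun c hc hne => MaLinBAI.minGap_le hc hne
  set δ := MaLinBAI.minGap θ 𝒜 aStar
  obtain ⟨β, hβ, hTβ, hwidth⟩ := I.exists_width hK hT hd hδ.le hgap
  have hR' : (0 : ℝ) < R := hR
  have hd' : (0 : ℝ) < d := by exact_mod_cast hd
  have hM' : (0 : ℝ) < M := by exact_mod_cast hM
  have hbound := I.measureReal_not_outputs_le hmem hmeas hindep
    (E := Real.exp (-(M * δ ^ 2) / (2 * R ^ 2 * β))) (Real.exp_nonneg _)
    fun p A hA hs a ha hne => I.measureReal_estimate_le hA hM (MaLinBAI.roundBudget_pos hK hT) hR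
      hindep hsub ha hs hδ hβ (hδ.trans_le (hgap a (hA ha) hne)) (hwidth p A hA hs a ha hne)
  have hn := MaLinBAI.numRounds_lt_logb_add_one hK
  refine hbound.trans ?_
  have hexp : -(M * δ ^ 2) / (2 * (R : ℝ) ^ 2 * β) ≤
      -((T : ℝ) * M * δ ^ 2) / (32 * (R : ℝ) ^ 2 * d * Real.logb 2 𝒜.card) := by
    rw [neg_div, neg_div, neg_le_neg_iff, div_le_div_iff₀ (by positivity) (by positivity)]
    calc (T : ℝ) * M * δ ^ 2 * (2 * R ^ 2 * β) = 2 * M * δ ^ 2 * R ^ 2 * (T * β) := by ring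
      _ ≤ 2 * M * δ ^ 2 * R ^ 2 * (16 * d * Real.logb 2 𝒜.card) := by gcongr
      _ = _ := by ring
  -- The prefactor uses `⌈log K⌉ < log K + 1 ≤ 2 log K`.
  exact mul_le_mul (by linarith) (Real.exp_le_exp.2 hexp) (Real.exp_nonneg _) (by linarith)
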